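/- Let $\mathcal{A}$ be an abelian category, with classes $\mathrm{Proj}(\mathcal{A})$ of projective and $\mathrm{Inj}(\mathcal{A})$ of injective objects. For classes of objects $\mathcal{P},\mathcal{Q}\subseteq\mathcal{A}$ write $\mathcal{P}\perp\mathcal{Q}$ if $\mathrm{Ext}^i_{\mathcal{A}}(P,Q)=0$ for all $P\in\mathcal{P}$, $Q\in\mathcal{Q}$ and $i>0$. A pair $(\mathcal{X},\mathcal{Y})$ of classes of objects of $\mathcal{A}$ is *GP-admissible* if: every $A\in\mathcal{A}$ admits an epimorphism $X\to A$ with $X\in\mathcal{X}$; $\mathcal{X}$ and $\mathcal{Y}$ are closed under finite coproducts and $\mathcal{X}$ is closed under extensions; every $X\in\mathcal{X}$ admits a short exact sequence $0\to X\to W\to X'\to 0$ with $W\in\mathcal{X}\cap\mathcal{Y}$ and $X'\in\mathcal{X}$; and $\mathcal{X}\perp\mathcal{Y}$. Dually, $(\mathcal{Z},\mathcal{W})$ is *GI-admissible* if: every $A\in\mathcal{A}$ admits a monomorphism $A\to W$ with $W\in\mathcal{W}$; $\mathcal{Z}$ and $\mathcal{W}$ are closed under finite products and $\mathcal{W}$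 is closed under extensions; every $W\in\mathcal{W}$ admits a short exact sequence $0\to W'\to V\to W\to 0$ with $V\in\mathcal{Z}\cap\mathcal{W}$ and $W'\in\mathcal{W}$; and $\mathcal{Z}\perp\mathcal{W}$. An object is *$(\mathcal{X},\mathcal{Y})$-Gorenstein projective* if it is a cycle of an exact $\mathbb{Z}$-indexed complex $K$ with all terms in $\mathcal{X}$ such that $\mathrm{Hom}_{\mathcal{A}}(K,Y)$ is exact for all $Y\in\mathcal{Y}$; write $\mathcal{GP}_{(\mathcal{X},\mathcal{Y})}$ for the class of these objects. An object is *$(\mathcal{Z},\mathcal{W})$-Gorenstein injective* if it is a cycle of an exact $\mathbb{Z}$-indexed complex $K$ with all terms in $\mathcal{W}$ such that $\mathrm{Hom}_{\mathcal{A}}(Z,K)$ is exact for all $Z\in\mathcal{Z}$; write $\mathcal{GI}_{(\mathcal{Z},\mathcal{W})}$ for the class of these objects. For $M\in\mathcal{A}$, let $\mathrm{Gpd}_{(\mathcal{X},\mathcal{Y})}(M)\in\mathbb{N}\cup\{\infty\}$ be the least $n\ge 0$ for which there is an exact sequence $0\to G_n\to\cdots\to G_0\to M\to 0$ with all $G_i\in\mathcal{GP}_{(\mathcal{X},\mathcal{Y})}$,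 and let $\mathrm{Gid}_{(\mathcal{Z},\mathcal{W})}(M)$ be the least $n\ge 0$ for which there is an exact sequence $0\to M\to G_0\to\cdots\to G_n\to 0$ with all $G_i\in\mathcal{GI}_{(\mathcal{Z},\mathcal{W})}$ (each being $\infty$ if no such $n$ exists). Put $$\mathrm{gl.GPD}_{(\mathcal{X},\mathcal{Y})}(\mathcal{A})=\sup_{M\in\mathcal{A}}\mathrm{Gpd}_{(\mathcal{X},\mathcal{Y})}(M),\qquad \mathrm{gl.GID}_{(\mathcal{Z},\mathcal{W})}(\mathcal{A})=\sup_{M\in\mathcal{A}}\mathrm{Gid}_{(\mathcal{Z},\mathcal{W})}(M)$$ in $\mathbb{N}\cup\{\infty\}$. **Statement.** Let $(\mathcal{X},\mathcal{Y})$ be GP-admissible with $\mathcal{X}\cap\mathcal{Y}=\mathrm{Proj}(\mathcal{A})$ and let $(\mathcal{Z},\mathcal{W})$ be GI-admissible with $\mathcal{Z}\cap\mathcal{W}=\mathrm{Inj}(\mathcal{A})$. Suppose that $\mathrm{Gpd}_{(\mathcal{X},\mathcal{Y})}(M)<\infty$ and $\mathrm{Gid}_{(\mathcal{Z},\mathcal{W})}(M)<\infty$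 for every $M\in\mathcal{A}$. Then $$\mathrm{gl.GPD}_{(\mathcal{X},\mathcal{Y})}(\mathcal{A})=\mathrm{gl.GID}_{(\mathcal{Z},\mathcal{W})}(\mathcal{A}).$$ -/

import Mathlib

open CategoryTheory CategoryTheory.Limits CategoryTheory.Abelian

universe v u

namespace RelGorenstein

variable {C : Type u} [Category.{v} C] [Abelian C]

/-- `P ⟂ Q`: the groups `Ext^i(A, B)` vanish for all `A ∈ P`, `B ∈ Q` and all `i > 0`.
(The universe in which Mathlib realizes the `Ext`-groups is irrelevant here; the standard choice,
which is available in every abelian category, is used.) -/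
def ExtOrthogonal (P Q : ObjectProperty C) : Prop :=
  letI := HasExt.standard C
  ∀ ⦃A B : C⦄, P A → Q B → ∀ i : ℕ, 0 < i → Subsingleton (Ext.{max u v} A B i)

/-- `(𝒳, 𝒴)` is a GP-admissible pair of classes of objects. -/
structure IsGPAdmissible (𝒳 𝒴 : ObjectProperty C) : Prop where
  /-- every object is a quotient of an object of `𝒳` -/
  exists_epi : ∀ A : C, ∃ (X : C) (p : X ⟶ A), 𝒳 X ∧ Epi p
  closed_coprod_left : 𝒳.IsClosedUnderFiniteCoproducts
  closed_coprod_right : 𝒴.IsClosedUnderFiniteCoproducts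
  closed_ext : 𝒳.IsClosedUnderExtensions
  /-- for `X ∈ 𝒳` there is a short exact sequence `0 → X → W → X' → 0` with
  `W ∈ 𝒳 ∩ 𝒴` and `X' ∈ 𝒳` -/
  cogenerator : ∀ X : C, 𝒳 X → ∃ (W X' : C) (i : X ⟶ W) (p : W ⟶ X') (w : i ≫ p = 0),
    (ShortComplex.mk i p w).ShortExact ∧ 𝒳 W ∧ 𝒴 W ∧ 𝒳 X'
  orthogonal : ExtOrthogonal 𝒳 𝒴

/-- `(𝒵, 𝒲)` is a GI-admissible pair of classes of objects: the notion dual to GP-admissibility,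
i.e. `(𝒲ᵒᵖ, 𝒵ᵒᵖ)` is GP-admissible in the opposite category. -/
structure IsGIAdmissible (𝒵 𝒲 : ObjectProperty C) : Prop where
  /-- every object is a subobject of an object of `𝒲` -/
  exists_mono : ∀ A : C, ∃ (W : C) (i : A ⟶ W), 𝒲 W ∧ Mono i
  closed_prod_left : 𝒵.IsClosedUnderFiniteProducts
  closed_prod_right : 𝒲.IsClosedUnderFiniteProducts
  closed_ext : 𝒲.IsClosedUnderExtensions
  /-- for `W ∈ 𝒲` there is a short exact sequence `0 → W' → V → W → 0` with
  `V ∈ 𝒵 ∩ 𝒲` and `W' ∈ 𝒲` -/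
  generator : ∀ W : C, 𝒲 W → ∃ (W' V : C) (i : W' ⟶ V) (p : V ⟶ W) (w : i ≫ p = 0),
    (ShortComplex.mk i p w).ShortExact ∧ 𝒵 V ∧ 𝒲 V ∧ 𝒲 W'
  orthogonal : ExtOrthogonal 𝒵 𝒲

/-- The complex of abelian groups `Hom(K, Y)` is exact: at each degree, every `f : Kⁿ ⟶ Y` which is
a cocycle (`dⁿ⁻¹ ≫ f = 0`) is a coboundary (`f = dⁿ ≫ g`). -/
def HomToExact (K : CochainComplex C ℤ) (Y : C) : Prop :=
  ∀ (n : ℤ) (f : K.X n ⟶ Y), K.d (n - 1) n ≫ f = 0 →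
    ∃ g : K.X (n + 1) ⟶ Y, K.d n (n + 1) ≫ g = f

/-- The complex of abelian groups `Hom(Z, K)` is exact: at each degree, every `f : Z ⟶ Kⁿ` which is
a cocycle (`f ≫ dⁿ = 0`) is a coboundary (`f = g ≫ dⁿ⁻¹`). -/
def HomFromExact (K : CochainComplex C ℤ) (Z : C) : Prop :=
  ∀ (n : ℤ) (f : Z ⟶ K.X n), f ≫ K.d n (n + 1) = 0 →
    ∃ g : Z ⟶ K.X (n - 1), g ≫ K.d (n - 1) n = f

/-- The class of `(𝒳, 𝒴)`-Gorenstein projective objects: the objects `M` that are (isomorphic to)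
a cycle of an exact complex with terms in `𝒳` which stays exact under `Hom(-, Y)`, `Y ∈ 𝒴`. -/
def GorensteinProjective (𝒳 𝒴 : ObjectProperty C) : ObjectProperty C := fun M =>
  ∃ K : CochainComplex C ℤ, K.Acyclic ∧ (∀ n, 𝒳 (K.X n)) ∧ (∀ Y, 𝒴 Y → HomToExact K Y) ∧
    ∃ n : ℤ, Nonempty (K.cycles n ≅ M)

/-- The class of `(𝒵, 𝒲)`-Gorenstein injective objects: the objects `M` that are (isomorphic to)
a cycle of an exact complex with terms in `𝒲` which stays exact under `Hom(Z, -)`, `Z ∈ 𝒵`. -/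
def GorensteinInjective (𝒵 𝒲 : ObjectProperty C) : ObjectProperty C := fun M =>
  ∃ K : CochainComplex C ℤ, K.Acyclic ∧ (∀ n, 𝒲 (K.X n)) ∧ (∀ Z, 𝒵 Z → HomFromExact K Z) ∧
    ∃ n : ℤ, Nonempty (K.cycles n ≅ M)

/-- `HasResolution P n M`: there is an exact sequence `0 → X_n → ⋯ → X_1 → X_0 → M → 0` with all
`X_i ∈ P`, presented as the iteration of the short exact sequences it is spliced from:
`0 → K → X_0 → M → 0`, where `K` has such a sequence of length `n - 1`. -/
def HasResolution (P : ObjectProperty C) : ℕ → C → Prop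
  | 0, M => ∃ X : C, P X ∧ Nonempty (X ≅ M)
  | n + 1, M => ∃ (K X : C) (i : K ⟶ X) (p : X ⟶ M) (w : i ≫ p = 0),
      (ShortComplex.mk i p w).ShortExact ∧ P X ∧ HasResolution P n K

/-- `HasCoresolution P n M`: there is an exact sequence `0 → M → X_0 → X_1 → ⋯ → X_n → 0` with all
`X_i ∈ P`, presented as the iteration of the short exact sequences it is spliced from:
`0 → M → X_0 → L → 0`, where `L` has such a sequence of length `n - 1`. -/
def HasCoresolution (P : ObjectProperty C) : ℕ → C → Prop
  | 0, M => ∃ X : C, P X ∧ Nonempty (M ≅ X)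
  | n + 1, M => ∃ (X L : C) (i : M ⟶ X) (p : X ⟶ L) (w : i ≫ p = 0),
      (ShortComplex.mk i p w).ShortExact ∧ P X ∧ HasCoresolution P n L

/-- The `P`-resolution dimension of `M`: the least `n` such that `HasResolution P n M`,
and `⊤` if there is none. -/
noncomputable def resdim (P : ObjectProperty C) (M : C) : ℕ∞ :=
  ⨅ (n : ℕ) (_ : HasResolution P n M), (n : ℕ∞)

/-- The `P`-coresolution dimension of `M`: the least `n` such that `HasCoresolution P n M`,
and `⊤` if there is none. -/
noncomputable def coresdim (P : ObjectProperty C) (M : C) : ℕ∞ :=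
  ⨅ (n : ℕ) (_ : HasCoresolution P n M), (n : ℕ∞)

/-- `P^∧`: the class of objects of finite `P`-resolution dimension. -/
def finiteResdim (P : ObjectProperty C) : ObjectProperty C := fun M => resdim P M < ⊤

/-- `P^∨`: the class of objects of finite `P`-coresolution dimension. -/
def finiteCoresdim (P : ObjectProperty C) : ObjectProperty C := fun M => coresdim P M < ⊤

/-- The `(𝒳, 𝒴)`-Gorenstein projective dimension of `M`. -/
noncomputable def Gpd (𝒳 𝒴 : ObjectProperty C) (M : C) : ℕ∞ :=
  resdim (GorensteinProjective 𝒳 𝒴) M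

/-- The `(𝒵, 𝒲)`-Gorenstein injective dimension of `M`. -/
noncomputable def Gid (𝒵 𝒲 : ObjectProperty C) (M : C) : ℕ∞ :=
  coresdim (GorensteinInjective 𝒵 𝒲) M

/-- The global `(𝒳, 𝒴)`-Gorenstein projective dimension of the category. -/
noncomputable def glGPD (𝒳 𝒴 : ObjectProperty C) : ℕ∞ := ⨆ M : C, Gpd 𝒳 𝒴 M

/-- The global `(𝒵, 𝒲)`-Gorenstein injective dimension of the category. -/
noncomputable def glGID (𝒵 𝒲 : ObjectProperty C) : ℕ∞ := ⨆ M : C, Gid 𝒵 𝒲 M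

end RelGorenstein

open scoped ZeroObject

/-! The Gorenstein projectives form the largest class of objects that are left orthogonal to `𝒴` and
embed into an object of `𝒳` with cokernel again in the class. This is `SyzygyObject`; membership is
proved coinductively, by exhibiting any class with this property. Since `𝒳 ⊓ 𝒴 = Proj`, the
embedding can be chosen into a projective `W`, and `Ext^1(G, W) = 0` for `G` in the class, so
extensions of `G` by `W` split. Hence the class is closed under extensions.

Two facts carry the theorem. An object of Gorenstein projective dimension at most `n` embeds into
one of projective dimension at most `n`; for an injective object the embedding splits, so `Ext^i(I,
-) = 0` for `i > n` (`vanishing_of_injective`). Conversely, an object `M` of finite dimension has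
dimension at most `n` once `Ext^i(M, P) = 0` for all projective `P` and `i > n`
(`exists_hasResolution_le`).

If gl.GPD is at most `n`, the first fact gives `Ext^i(I, M) = 0` for all injective `I`, all `M` and
`i > n`, and the dual of the second bounds every Gorenstein injective dimension by `n`. The reverse
inequality is dual. Both are instances of `iSup_resdim_le`, stated for an abstract vanishing
relation that makes sense in `C` and in `Cᵒᵖ`. -/

namespace RelGorenstein

/-! ### Short exact sequences: pushouts, quotients, splittings. -/

section Diagrams

variable {C : Type u} [Category.{v} C] [Abelian C]

/-- There is a short exact sequence `0 ⟶ A ⟶ B ⟶ D ⟶ 0`. -/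
def HasSES (A B D : C) : Prop :=
  ∃ (f : A ⟶ B) (g : B ⟶ D) (w : f ≫ g = 0), (ShortComplex.mk f g w).ShortExact

lemma exists_desc_of_shortExact {A B D T : C} {f : A ⟶ B} {g : B ⟶ D} {w : f ≫ g = 0}
    (h : (ShortComplex.mk f g w).ShortExact) (k : B ⟶ T) (hk : f ≫ k = 0) :
    ∃ l : D ⟶ T, g ≫ l = k := by
  have := h.epi_g
  exact ⟨h.exact.desc k hk, h.exact.g_desc k hk⟩

lemma exists_lift_of_shortExact {A B D T : C} {f : A ⟶ B} {g : B ⟶ D} {w : f ≫ g = 0}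
    (h : (ShortComplex.mk f g w).ShortExact) (k : T ⟶ B) (hk : k ≫ g = 0) :
    ∃ l : T ⟶ A, l ≫ f = k := by
  have := h.mono_f
  exact ⟨h.exact.lift k hk, h.exact.lift_f k hk⟩

lemma shortExact_of_exists_desc {A B D : C} {f : A ⟶ B} {g : B ⟶ D} (w : f ≫ g = 0) [Mono f]
    [Epi g] (h : ∀ {T : C} (k : B ⟶ T), f ≫ k = 0 → ∃ l : D ⟶ T, g ≫ l = k) :
    (ShortComplex.mk f g w).ShortExact where
  exact := by
    refine ShortComplex.exact_of_g_is_cokernel _ (CokernelCofork.IsColimit.ofπ' _ _ ?_)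
    intro T k hk
    exact ⟨(h k hk).choose, (h k hk).choose_spec⟩

lemma shortExact_of_exists_lift {A B D : C} {f : A ⟶ B} {g : B ⟶ D} (w : f ≫ g = 0) [Mono f]
    [Epi g] (h : ∀ {T : C} (k : T ⟶ B), k ≫ g = 0 → ∃ l : T ⟶ A, l ≫ f = k) :
    (ShortComplex.mk f g w).ShortExact where
  exact := by
    refine ShortComplex.exact_of_f_is_kernel _ (KernelFork.IsLimit.ofι' _ _ ?_)
    intro T k hk
    exact ⟨(h k hk).choose, (h k hk).choose_spec⟩

/-- In a pushout square, a short exact sequence along one side induces one along the opposite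
side, provided the induced map is a monomorphism. -/
lemma hasSES_of_isPushout {A B D X Q : C} {f : A ⟶ B} {g : B ⟶ D} {w : f ≫ g = 0}
    (h : (ShortComplex.mk f g w).ShortExact) {a : A ⟶ X} {b : B ⟶ Q} {x : X ⟶ Q}
    (sq : IsPushout f a b x) : HasSES X Q D := by
  have := h.epi_g
  have := h.mono_f
  dsimp at *
  have hx : Mono x := (MorphismProperty.monomorphisms C).of_isPushout sq.flip
    (MorphismProperty.monomorphisms.infer_property f)
  have hb : b ≫ sq.desc g 0 (by simp [w]) = g := sq.inl_desc _ _ _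
  have : Epi (sq.desc g 0 (by simp [w])) := by
    have : Epi (b ≫ sq.desc g 0 (by simp [w])) := by rw [hb]; infer_instance
    exact epi_of_epi b _
  refine ⟨x, sq.desc g 0 _, sq.inr_desc _ _ _, shortExact_of_exists_desc _ ?_⟩
  intro T k hk
  obtain ⟨l, hl⟩ := exists_desc_of_shortExact h (b ≫ k)
    (by rw [sq.w_assoc, hk, comp_zero])
  exact ⟨l, sq.hom_ext (by rw [reassoc_of% hb, hl]) (by simp [hk])⟩

lemma HasSES.exists_pushout {A B D X D' : C} (h : HasSES A B D) (h' : HasSES A X D') :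
    ∃ Q : C, HasSES X Q D ∧ HasSES B Q D' := by
  obtain ⟨f, g, w, h⟩ := h
  obtain ⟨a, b, w', h'⟩ := h'
  exact ⟨pushout f a, hasSES_of_isPushout h (IsPushout.of_hasPushout f a),
    hasSES_of_isPushout h' (IsPushout.of_hasPushout f a).flip⟩

/-- The third isomorphism theorem: subobjects `A ⊆ B ⊆ Q` with `B / A = D` and `Q / B = F` give
`Q / A = E`, an extension of `F` by `D`. -/
lemma HasSES.exists_quotient {A B D Q F : C} (h : HasSES A B D) (h' : HasSES B Q F) :
    ∃ E : C, HasSES A Q E ∧ HasSES D E F := by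
  obtain ⟨f, g, w, h⟩ := h
  obtain ⟨a, b, w', h'⟩ := h'
  have := h.mono_f
  have := h'.mono_f
  have := h.epi_g
  dsimp at *
  have sq := IsPushout.of_hasPushout a g
  refine ⟨pushout a g, ⟨f ≫ a, pushout.inl a g, ?_, ?_⟩, hasSES_of_isPushout h' sq⟩
  · rw [Category.assoc, sq.w, reassoc_of% w, zero_comp]
  · refine shortExact_of_exists_desc _ ?_
    intro T k hk
    obtain ⟨l, hl⟩ := exists_desc_of_shortExact h (a ≫ k) (by simpa using hk)
    exact ⟨pushout.desc k l hl.symm, pushout.inl_desc _ _ _⟩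

/-- A split short exact sequence may be reversed. -/
lemma hasSES_swap_of_retraction {A B D : C} {f : A ⟶ B} {g : B ⟶ D} {w : f ≫ g = 0}
    (h : (ShortComplex.mk f g w).ShortExact) {r : B ⟶ A} (hr : f ≫ r = 𝟙 A) : HasSES D B A := by
  have := h.epi_g
  let s := ShortComplex.Splitting.ofExactOfRetraction _ h.exact r hr h.epi_g
  have : Mono s.s := mono_of_mono_fac s.s_g
  have : Epi r := epi_of_epi_fac hr
  refine ⟨s.s, r, s.s_r, shortExact_of_exists_lift _ fun k hk => ⟨k ≫ g, ?_⟩⟩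
  have := s.id
  dsimp at this
  rw [Category.assoc, ← Category.comp_id k]
  conv_rhs => rw [← this]
  have hr' : s.r = r := rfl
  simp [hr', reassoc_of% hk]

/-- If `Q` is a split extension of `D` by `A`, then an embedding of `D` gives one of `Q`. -/
lemma hasSES_biprod_of_retraction {A Q D X D' : C} {f : A ⟶ Q} {g : Q ⟶ D} {w : f ≫ g = 0}
    (h : (ShortComplex.mk f g w).ShortExact) {r : Q ⟶ A} (hr : f ≫ r = 𝟙 A)
    (h' : HasSES D X D') : HasSES Q (A ⊞ X) D' := by
  obtain ⟨a, b, w', h'⟩ := h'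
  have := h.epi_g
  have := h.mono_f
  have := h'.epi_g
  have := h'.mono_f
  dsimp at *
  let s := ShortComplex.Splitting.ofExactOfRetraction _ h.exact r hr h.epi_g
  have hid : r ≫ f + g ≫ s.s = 𝟙 Q := s.id
  have hsr : s.s ≫ r = 0 := s.s_r
  have hsg : s.s ≫ g = 𝟙 D := s.s_g
  have : Mono (biprod.lift r (g ≫ a)) := by
    refine Preadditive.mono_of_cancel_zero _ fun k hk => ?_
    have h1 : k ≫ r = 0 := by simpa using hk =≫ biprod.fst
    have h2 : k ≫ g = 0 := by
      rw [← cancel_mono a]; simpa using hk =≫ biprod.snd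
    rw [← Category.comp_id k, ← hid]
    simp [reassoc_of% h1, reassoc_of% h2]
  refine ⟨biprod.lift r (g ≫ a), biprod.snd ≫ b, by simp [w'],
    shortExact_of_exists_lift _ fun k hk => ?_⟩
  obtain ⟨l, hl⟩ := exists_lift_of_shortExact h' (k ≫ biprod.snd) (by simpa using hk)
  refine ⟨k ≫ biprod.fst ≫ f + l ≫ s.s, ?_⟩
  ext
  · simp [hr, hsr]
  · simp [reassoc_of% w, reassoc_of% hsg, hl]

lemma hasSES_of_iso_zero {A B Z : C} (e : A ≅ B) (hZ : IsZero Z) : HasSES A B Z :=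
  ⟨e.hom, 0, comp_zero, by
    have : Epi (0 : B ⟶ Z) := ⟨fun _ _ _ => hZ.eq_of_src _ _⟩
    exact shortExact_of_exists_lift _ fun k _ => ⟨k ≫ e.inv, by simp⟩⟩

lemma HasSES.op {A B D : C} (h : HasSES A B D) :
    HasSES (Opposite.op D) (Opposite.op B) (Opposite.op A) := by
  obtain ⟨f, g, w, h⟩ := h
  exact ⟨g.op, f.op, by rw [← op_comp, w]; rfl, h.op⟩

lemma HasSES.unop {A B D : Cᵒᵖ} (h : HasSES A B D) : HasSES D.unop B.unop A.unop := by
  obtain ⟨f, g, w, h⟩ := h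
  exact ⟨g.unop, f.unop, by rw [← unop_comp, w]; rfl, h.unop⟩

end Diagrams

/-! ### Vanishing of Ext in a category and in its opposite. -/

section Vanishing

variable {C : Type u} [Category.{v} C] [Abelian C]

/-- The formal properties of the relation `E i A Y`, "`Ext^i(A, Y) = 0`", that come from the
contravariant long exact sequences. The relation is kept abstract so that it may be instantiated
both in a category and in its opposite. -/
structure IsExtVanishing (E : ℕ → C → C → Prop) : Prop where
  left : ∀ {A B D : C}, HasSES A B D → ∀ (i : ℕ) (Y : C), E i B Y → E (i + 1) D Y → E i A Y
  middle : ∀ {A B D : C}, HasSES A B D → ∀ (i : ℕ) (Y : C), E i A Y → E i D Y → E i B Y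
  right : ∀ {A B D : C}, HasSES A B D → ∀ (i : ℕ) (Y : C),
    E i A Y → E (i + 1) B Y → E (i + 1) D Y
  retract : ∀ {A B : C} (f : A ⟶ B) (g : B ⟶ A), f ≫ g = 𝟙 A →
    ∀ (i : ℕ) (Y : C), E i B Y → E i A Y
  extend : ∀ {A B D : C} {f : A ⟶ B} {g : B ⟶ D} {w : f ≫ g = 0},
    (ShortComplex.mk f g w).ShortExact → ∀ Y : C, E 1 D Y → ∀ u : A ⟶ Y, ∃ t : B ⟶ Y, f ≫ t = u
  of_extend : ∀ {A B D : C} {f : A ⟶ B} {g : B ⟶ D} {w : f ≫ g = 0},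
    (ShortComplex.mk f g w).ShortExact → ∀ Y : C, (∀ u : A ⟶ Y, ∃ t : B ⟶ Y, f ≫ t = u) →
    E 1 B Y → E 1 D Y
  projective : ∀ (P : C), Projective P → ∀ (i : ℕ) (Y : C), E (i + 1) P Y

/-- The vanishing of the `Ext`-groups of `C`. -/
def ExtVanishes (i : ℕ) (A Y : C) : Prop :=
  letI := HasExt.standard C
  Subsingleton (Ext.{max u v} A Y i)

/-- The vanishing of the `Ext`-groups of `C`, as a relation on the opposite category. -/
def OpExtVanishes (i : ℕ) (A Y : Cᵒᵖ) : Prop :=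
  ExtVanishes i Y.unop A.unop

lemma extVanishes_iff (i : ℕ) (A Y : C) : ExtVanishes i A Y ↔
    letI := HasExt.standard C
    ∀ x : Ext.{max u v} A Y i, x = 0 := by
  let := HasExt.standard C
  exact ⟨fun h x => @Subsingleton.elim _ h _ _, fun h => ⟨fun x y => by rw [h x, h y]⟩⟩

lemma isExtVanishing_extVanishes : IsExtVanishing (ExtVanishes (C := C)) := by
  let := HasExt.standard C
  constructor
  · rintro A B D ⟨f, g, w, h⟩ i Y h₂ h₃
    rw [extVanishes_iff] at *
    intro x
    obtain ⟨y, rfl⟩ := Ext.contravariant_sequence_exact₁ h Y x (add_comm 1 i) (h₃ _)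
    rw [h₂ y, Ext.comp_zero]
  · rintro A B D ⟨f, g, w, h⟩ i Y h₁ h₃
    rw [extVanishes_iff] at *
    intro x
    obtain ⟨y, rfl⟩ := Ext.contravariant_sequence_exact₂ h Y x (h₁ _)
    rw [h₃ y, Ext.comp_zero]
  · rintro A B D ⟨f, g, w, h⟩ i Y h₁ h₂
    rw [extVanishes_iff] at *
    intro x
    obtain ⟨y, rfl⟩ := Ext.contravariant_sequence_exact₃ h Y x (h₂ _) (add_comm 1 i)
    rw [h₁ y, Ext.comp_zero]
  · intro A B f g hfg i Y hB
    rw [extVanishes_iff] at *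
    intro x
    rw [← Ext.mk₀_id_comp x, ← hfg, ← Ext.mk₀_comp_mk₀_assoc, hB ((Ext.mk₀ g).comp x _),
      Ext.comp_zero]
  · intro A B D f g w h Y hD u
    rw [extVanishes_iff] at *
    obtain ⟨y, hy⟩ := Ext.contravariant_sequence_exact₁ h Y (Ext.mk₀ u) (add_zero 1) (hD _)
    obtain ⟨t, rfl⟩ := (Ext.mk₀_bijective _ _).2 y
    exact ⟨t, (Ext.mk₀_bijective _ _).1 (by simpa using hy)⟩
  · intro A B D f g w h Y hu hB
    rw [extVanishes_iff] at *
    intro x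
    -- As `Ext^1(B, Y) = 0`, every class in `Ext^1(D, Y)` is the pushout of the given extension
    -- along some `u : A ⟶ Y`; it vanishes because `u` factors through `f`.
    obtain ⟨y, rfl⟩ := Ext.contravariant_sequence_exact₃ h Y x (hB _) (add_zero 1)
    obtain ⟨u, rfl⟩ := (Ext.mk₀_bijective _ _).2 y
    obtain ⟨t, rfl⟩ := hu u
    rw [← Ext.mk₀_comp_mk₀]
    exact h.extClass_comp_assoc _
  · intro P hP i Y
    exact Ext.subsingleton_of_projective P Y i

lemma exists_lift_of_extVanishes {A B D Y : C} {f : A ⟶ B} {g : B ⟶ D} {w : f ≫ g = 0}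
    (h : (ShortComplex.mk f g w).ShortExact) (hA : ExtVanishes 1 Y A) (u : Y ⟶ D) :
    ∃ t : Y ⟶ B, t ≫ g = u := by
  let := HasExt.standard C
  rw [extVanishes_iff] at hA
  obtain ⟨y, hy⟩ := Ext.covariant_sequence_exact₃ _ h (Ext.mk₀ u) (zero_add 1) (hA _)
  obtain ⟨t, rfl⟩ := (Ext.mk₀_bijective _ _).2 y
  exact ⟨t, (Ext.mk₀_bijective _ _).1 (by simpa using hy)⟩

lemma extVanishes_of_exists_lift {A B D Y : C} {f : A ⟶ B} {g : B ⟶ D} {w : f ≫ g = 0}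
    (h : (ShortComplex.mk f g w).ShortExact) (hu : ∀ u : Y ⟶ D, ∃ t : Y ⟶ B, t ≫ g = u)
    (hB : ExtVanishes 1 Y B) : ExtVanishes 1 Y A := by
  let := HasExt.standard C
  rw [extVanishes_iff] at *
  intro x
  obtain ⟨y, rfl⟩ := Ext.covariant_sequence_exact₁ _ h x (hB _) (zero_add 1)
  obtain ⟨u, rfl⟩ := (Ext.mk₀_bijective _ _).2 y
  obtain ⟨t, rfl⟩ := hu u
  rw [← Ext.mk₀_comp_mk₀, Ext.comp_assoc (a₂₃ := 1) _ _ _ (by lia) (by lia) (by lia)]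
  exact (congrArg (fun z => (Ext.mk₀ t).comp z (zero_add 1)) h.comp_extClass).trans
    (Ext.comp_zero _ _ _ _ _)

/-- Contravariant sequences over `Cᵒᵖ` are covariant sequences over `C`. All Ext groups stay in `C`,
so no comparison of Ext with that of the opposite category is needed. -/
lemma isExtVanishing_opExtVanishes : IsExtVanishing (OpExtVanishes (C := C)) := by
  let := HasExt.standard C
  constructor
  · intro A B D h i Y h₂ h₃
    obtain ⟨f, g, w, h⟩ := h.unop
    rw [OpExtVanishes, extVanishes_iff] at *
    intro x
    obtain ⟨y, rfl⟩ := Ext.covariant_sequence_exact₃ _ h x rfl (h₃ _)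
    rw [h₂ y, Ext.zero_comp]
  · intro A B D h i Y h₁ h₃
    obtain ⟨f, g, w, h⟩ := h.unop
    rw [OpExtVanishes, extVanishes_iff] at *
    intro x
    obtain ⟨y, rfl⟩ := Ext.covariant_sequence_exact₂ _ h x (h₁ _)
    rw [h₃ y, Ext.zero_comp]
  · intro A B D h i Y h₁ h₂
    obtain ⟨f, g, w, h⟩ := h.unop
    rw [OpExtVanishes, extVanishes_iff] at *
    intro x
    obtain ⟨y, rfl⟩ := Ext.covariant_sequence_exact₁ _ h x (h₂ _) rfl
    rw [h₁ y, Ext.zero_comp]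
  · intro A B f g hfg i Y hB
    rw [OpExtVanishes, extVanishes_iff] at *
    intro x
    have hfg' : g.unop ≫ f.unop = 𝟙 A.unop := by rw [← unop_comp, hfg]; rfl
    rw [← Ext.comp_mk₀_id x, ← hfg', ← Ext.mk₀_comp_mk₀,
      ← Ext.comp_assoc_of_second_deg_zero, hB (x.comp (Ext.mk₀ g.unop) _), Ext.zero_comp]
  · intro A B D f g w h Y hD u
    obtain ⟨t, ht⟩ := exists_lift_of_extVanishes h.unop hD u.unop
    exact ⟨t.op, Quiver.Hom.unop_inj ht⟩
  · intro A B D f g w h Y hu hB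
    refine extVanishes_of_exists_lift h.unop (fun u => ?_) hB
    obtain ⟨t, ht⟩ := hu u.op
    exact ⟨t.unop, Quiver.Hom.op_inj ht⟩
  · intro P hP i Y
    have : Injective P.unop := inferInstance
    exact Ext.subsingleton_of_injective Y.unop P.unop i

end Vanishing

/-! ### Syzygy objects and their dimension theory. -/

section Core

variable {C : Type u} [Category.{v} C] [Abelian C]

/-- The class `S` is left orthogonal to `𝒴`, and each of its objects embeds into an object of `𝒳`
with cokernel in `S`. -/
def IsSyzygyClass (E : ℕ → C → C → Prop) (𝒳 𝒴 S : ObjectProperty C) : Prop :=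
  ∀ M, S M → (∀ Y, 𝒴 Y → ∀ i, E (i + 1) M Y) ∧ ∃ X M', 𝒳 X ∧ S M' ∧ HasSES M X M'

/-- The union of all classes `S` satisfying `IsSyzygyClass E 𝒳 𝒴 S`. -/
def SyzygyObject (E : ℕ → C → C → Prop) (𝒳 𝒴 : ObjectProperty C) : ObjectProperty C :=
  fun M => ∃ S, IsSyzygyClass E 𝒳 𝒴 S ∧ S M

/-- The consequences of GP-admissibility and `𝒳 ⊓ 𝒴 = Proj` that control the relative Gorenstein
projective dimension, for a vanishing relation `E`. -/
structure IsProjectiveFrame (E : ℕ → C → C → Prop) (𝒳 𝒴 : ObjectProperty C) : Prop where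
  isExtVanishing : IsExtVanishing E
  closed_ext : 𝒳.IsClosedUnderExtensions
  cogenerator : ∀ X, 𝒳 X → ∃ W X', Projective W ∧ 𝒳 X' ∧ HasSES X W X'
  orthogonal : ∀ X Y, 𝒳 X → 𝒴 Y → ∀ i, E (i + 1) X Y
  left_of_projective : ∀ P : C, Projective P → 𝒳 P
  right_of_projective : ∀ P : C, Projective P → 𝒴 P

/-- The defining condition passes to unions, so a largest such class exists. This is the coinduction
principle behind the closure properties. -/
lemma isSyzygyClass_syzygyObject (E : ℕ → C → C → Prop) (𝒳 𝒴 : ObjectProperty C) :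
    IsSyzygyClass E 𝒳 𝒴 (SyzygyObject E 𝒳 𝒴) := by
  rintro M ⟨S, hS, hM⟩
  obtain ⟨h, X, M', hX, hM', hs⟩ := hS M hM
  exact ⟨h, X, M', hX, ⟨S, hS, hM'⟩, hs⟩

variable {E : ℕ → C → C → Prop} {𝒳 𝒴 : ObjectProperty C}

namespace IsProjectiveFrame

lemma syzygyObject_of_left (F : IsProjectiveFrame E 𝒳 𝒴) {X : C} (hX : 𝒳 X) :
    SyzygyObject E 𝒳 𝒴 X := by
  refine ⟨𝒳, fun X hX => ?_, hX⟩
  obtain ⟨W, X', hW, hX', h⟩ := F.cogenerator X hX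
  exact ⟨fun Y hY i => F.orthogonal X Y hX hY i, W, X', F.left_of_projective W hW, hX', h⟩

/-- An object embedding into an object of `𝒳` with cokernel a syzygy object is a syzygy object,
if it is left orthogonal to `𝒴`. -/
lemma syzygyObject_of_hasSES {M X M' : C} (h : HasSES M X M') (hX : 𝒳 X)
    (hM' : SyzygyObject E 𝒳 𝒴 M') (hM : ∀ Y, 𝒴 Y → ∀ i, E (i + 1) M Y) :
    SyzygyObject E 𝒳 𝒴 M := by
  -- Adjoining the single object `M` to the largest class keeps the defining condition.
  refine ⟨fun N => N = M ∨ SyzygyObject E 𝒳 𝒴 N, ?_, Or.inl rfl⟩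
  rintro N (rfl | hN)
  · exact ⟨hM, X, M', hX, Or.inr hM', h⟩
  · obtain ⟨h, X, M', hX, hM', hs⟩ := isSyzygyClass_syzygyObject E 𝒳 𝒴 N hN
    exact ⟨h, X, M', hX, Or.inr hM', hs⟩

lemma syzygyObject_of_iso (F : IsProjectiveFrame E 𝒳 𝒴) {M N : C} (e : M ≅ N)
    (hM : SyzygyObject E 𝒳 𝒴 M) : SyzygyObject E 𝒳 𝒴 N := by
  obtain ⟨h, X, M', hX, hM', f, g, w, hs⟩ := isSyzygyClass_syzygyObject E 𝒳 𝒴 M hM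
  refine syzygyObject_of_hasSES (X := X) (M' := M') ⟨e.inv ≫ f, g, by simp [w], ?_⟩ hX hM'
    fun Y hY i => F.isExtVanishing.retract e.inv e.hom e.inv_hom_id _ _ (h Y hY i)
  exact ShortComplex.shortExact_of_iso
    (ShortComplex.isoMk e (Iso.refl X) (Iso.refl M') (by simp) (by simp)) hs

/-- Coinduction on the class of such extensions: pushing out `A ⟶ X₁` along `A ⟶ B` embeds `B` into
an extension of `X` by `X₁`, which lies in `𝒳`, with cokernel `A'`. -/
lemma syzygyObject_of_hasSES_right (F : IsProjectiveFrame E 𝒳 𝒴) {A B X : C}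
    (h : HasSES A B X) (hA : SyzygyObject E 𝒳 𝒴 A) (hX : 𝒳 X) : SyzygyObject E 𝒳 𝒴 B := by
  have hS := isSyzygyClass_syzygyObject E 𝒳 𝒴
  refine ⟨fun B => ∃ A X, HasSES A B X ∧ SyzygyObject E 𝒳 𝒴 A ∧ 𝒳 X, ?_, A, X, h, hA, hX⟩
  rintro B ⟨A, X, h, hA, hX⟩
  obtain ⟨hAY, X₁, A', hX₁, hA', hs⟩ := hS A hA
  refine ⟨fun Y hY i => F.isExtVanishing.middle h _ _ (hAY Y hY i) (F.orthogonal X Y hX hY i), ?_⟩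
  obtain ⟨Q, ⟨f, g, w, h₁⟩, h₂⟩ := h.exists_pushout hs
  have := F.closed_ext
  exact ⟨Q, A', 𝒳.prop_X₂_of_shortExact h₁ hX₁ hX,
    -- `A'` is in the coinductive class as an extension of `0` by itself.
    ⟨A', 0, hasSES_of_iso_zero (Iso.refl _) (isZero_zero C), hA',
      F.left_of_projective 0 inferInstance⟩, h₂⟩

/-- Each syzygy object embeds into a projective object with cokernel a syzygy object. -/
lemma exists_hasSES_projective (F : IsProjectiveFrame E 𝒳 𝒴) {M : C}
    (hM : SyzygyObject E 𝒳 𝒴 M) :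
    ∃ W M', Projective W ∧ SyzygyObject E 𝒳 𝒴 M' ∧ HasSES M W M' := by
  obtain ⟨-, X, M', hX, hM', hs⟩ := isSyzygyClass_syzygyObject E 𝒳 𝒴 M hM
  obtain ⟨W, X', hW, hX', hs'⟩ := F.cogenerator X hX
  obtain ⟨N, h₁, h₂⟩ := hs.exists_quotient hs'
  exact ⟨W, N, hW, F.syzygyObject_of_hasSES_right h₂ hM' hX', h₁⟩

lemma vanishing (_ : IsProjectiveFrame E 𝒳 𝒴) {M Y : C} (hM : SyzygyObject E 𝒳 𝒴 M)
    (hY : 𝒴 Y) (i : ℕ) : E (i + 1) M Y :=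
  (isSyzygyClass_syzygyObject E 𝒳 𝒴 M hM).1 Y hY i

/-- Coinduction on the class of extensions. With `A` embedded in a projective `W`, the pushout `Q`
is an extension of `D` by `W`. It splits, so `B ⊆ Q ⊆ W ⊞ X`, and the quotient by `B` is an
extension of `D'` by `A'`. -/
lemma syzygyObject_of_extension (F : IsProjectiveFrame E 𝒳 𝒴) {A B D : C}
    (h : HasSES A B D) (hA : SyzygyObject E 𝒳 𝒴 A) (hD : SyzygyObject E 𝒳 𝒴 D) :
    SyzygyObject E 𝒳 𝒴 B := by
  have hS := isSyzygyClass_syzygyObject E 𝒳 𝒴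
  refine ⟨fun B => ∃ A D, HasSES A B D ∧ SyzygyObject E 𝒳 𝒴 A ∧ SyzygyObject E 𝒳 𝒴 D, ?_,
    A, D, h, hA, hD⟩
  rintro B ⟨A, D, h, hA, hD⟩
  refine ⟨fun Y hY i => F.isExtVanishing.middle h _ _ (F.vanishing hA hY i)
    (F.vanishing hD hY i), ?_⟩
  obtain ⟨W, A', hW, hA', hs⟩ := F.exists_hasSES_projective hA
  obtain ⟨hDY, X, D', hX, hD', hs'⟩ := hS D hD
  obtain ⟨Q, ⟨f, g, w, h₁⟩, h₂⟩ := h.exists_pushout hs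
  -- Being projective, `W` lies in `𝒴`, so the identity of `W` extends along `W ⟶ Q`.
  obtain ⟨r, hr⟩ := F.isExtVanishing.extend h₁ W (hDY W (F.right_of_projective W hW) 0) (𝟙 W)
  obtain ⟨N, h₃, h₄⟩ := h₂.exists_quotient (hasSES_biprod_of_retraction h₁ hr hs')
  have := F.closed_ext
  exact ⟨W ⊞ X, N, 𝒳.prop_biprod (F.left_of_projective W hW) hX, ⟨A', D', h₄, hA', hD'⟩, h₃⟩

/-- Every object of finite relative Gorenstein projective dimension embeds into an object of finite
projective dimension, with cokernel a syzygy object. -/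
lemma exists_hasSES_hasResolution (F : IsProjectiveFrame E 𝒳 𝒴) (n : ℕ) {M : C}
    (hM : HasResolution (SyzygyObject E 𝒳 𝒴) n M) :
    ∃ H G, HasSES M H G ∧ SyzygyObject E 𝒳 𝒴 G ∧ HasResolution (isProjective C) n H := by
  induction n generalizing M with
  | zero =>
    obtain ⟨X, hX, ⟨e⟩⟩ := hM
    obtain ⟨W, G, hW, hG, h⟩ := F.exists_hasSES_projective (F.syzygyObject_of_iso e hX)
    exact ⟨W, G, h, hG, W, hW, ⟨Iso.refl W⟩⟩
  | succ n ih =>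
    obtain ⟨K, G, f, g, w, h, hG, hK⟩ := hM
    obtain ⟨H, G', hs, hG', hH⟩ := ih hK
    -- `Q` is an extension of `M` by `H` and also of `G'` by `G`, hence a syzygy object. Embedding
    -- it in a projective `W` gives `M = Q / H ⊆ N = W / H`, and `N` has a projective resolution one
    -- step longer than that of `H`.
    obtain ⟨Q, h₁, h₂⟩ := HasSES.exists_pushout ⟨f, g, w, h⟩ hs
    obtain ⟨W, Q', hW, hQ', h₃⟩ :=
      F.exists_hasSES_projective (F.syzygyObject_of_extension h₂ hG hG')
    obtain ⟨N, ⟨f', g', w', h₄⟩, h₅⟩ := h₁.exists_quotient h₃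
    exact ⟨N, Q', h₅, hQ', H, W, f', g', w', h₄, hW, hH⟩

end IsProjectiveFrame

lemma IsExtVanishing.vanishing_of_hasResolution (hE : IsExtVanishing E) (n : ℕ) {H : C}
    (hH : HasResolution (isProjective C) n H) (j : ℕ) (Y : C) : E (n + 1 + j) H Y := by
  induction n generalizing H with
  | zero =>
    obtain ⟨P, hP, ⟨e⟩⟩ := hH
    exact hE.retract e.inv e.hom e.inv_hom_id _ _
      (by rw [zero_add, add_comm]; exact hE.projective P hP j Y)
  | succ n ih =>
    obtain ⟨K, P, f, g, w, h, hP, hK⟩ := hH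
    have := hE.right ⟨f, g, w, h⟩ _ Y (ih hK) (hE.projective P hP _ Y)
    rwa [show n + 1 + 1 + j = n + 1 + j + 1 by lia]

namespace IsProjectiveFrame

/-- The embedding of `I` into an object of projective dimension at most `n` splits, so `I` inherits
the vanishing for every `Y`, not only those in `𝒴`. -/
lemma vanishing_of_injective (F : IsProjectiveFrame E 𝒳 𝒴) (n : ℕ) {I : C} [Injective I]
    (hI : HasResolution (SyzygyObject E 𝒳 𝒴) n I) (j : ℕ) (Y : C) : E (n + 1 + j) I Y := by
  obtain ⟨H, G, ⟨f, g, w, h⟩, -, hH⟩ := F.exists_hasSES_hasResolution n hI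
  have : Mono f := h.mono_f
  exact F.isExtVanishing.retract f (Injective.factorThru (𝟙 I) f) (Injective.comp_factorThru _ _)
    _ _ (F.isExtVanishing.vanishing_of_hasResolution n hH j Y)

/-- Dimension shifting along the first syzygy reduces to length one, since syzygy objects have no
Ext into projectives. There `M` becomes a direct summand, with projective complement, of a syzygy
object `Q`. -/
lemma hasResolution_of_vanishing (F : IsProjectiveFrame E 𝒳 𝒴) (n : ℕ) {M : C}
    (hM : HasResolution (SyzygyObject E 𝒳 𝒴) (n + 1) M)
    (hP : ∀ P : C, Projective P → E (n + 1) M P) :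
    HasResolution (SyzygyObject E 𝒳 𝒴) n M := by
  have hE := F.isExtVanishing
  induction n generalizing M with
  | zero =>
    obtain ⟨K, G, f, g, w, h, hG, K', hK', ⟨e⟩⟩ := hM
    obtain ⟨W, L, hW, hL, hs⟩ := F.exists_hasSES_projective (F.syzygyObject_of_iso e hK')
    obtain ⟨Q, ⟨f', g', w', h₁⟩, h₂⟩ := HasSES.exists_pushout ⟨f, g, w, h⟩ hs
    have hQ := F.syzygyObject_of_extension h₂ hG hL
    -- `Q` is an extension of `M` by the projective `W`; the hypothesis `Ext^1(M, W) = 0` splits it.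
    obtain ⟨r, hr⟩ := hE.extend h₁ W (hP W hW) (𝟙 W)
    have hMQ := hasSES_swap_of_retraction h₁ hr
    obtain ⟨V, Q', hV, hQ', h₃⟩ := F.exists_hasSES_projective hQ
    obtain ⟨N, h₄, h₅⟩ := hMQ.exists_quotient h₃
    refine ⟨M, syzygyObject_of_hasSES h₄ (F.left_of_projective V hV)
      (F.syzygyObject_of_extension h₅
        (F.syzygyObject_of_left (F.left_of_projective W hW)) hQ') fun Y hY i => ?_,
      ⟨Iso.refl M⟩⟩
    exact hE.left hMQ _ _ (F.vanishing hQ hY i) (hE.projective W hW _ _)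
  | succ n ih =>
    obtain ⟨K, G, f, g, w, h, hG, hK⟩ := hM
    refine ⟨K, G, f, g, w, h, hG, ih hK fun P hP' => ?_⟩
    exact hE.left ⟨f, g, w, h⟩ _ _ (F.vanishing hG (F.right_of_projective P hP') n) (hP P hP')

/-- If `Ext^i(-, P) = 0` for all projective objects `P` and `i > n`, then every object of finite
relative Gorenstein projective dimension has dimension at most `n`. -/
lemma exists_hasResolution_le (F : IsProjectiveFrame E 𝒳 𝒴) (n m : ℕ) {M : C}
    (hM : HasResolution (SyzygyObject E 𝒳 𝒴) m M)
    (hP : ∀ P : C, Projective P → ∀ j, E (n + 1 + j) M P) :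
    ∃ k ≤ n, HasResolution (SyzygyObject E 𝒳 𝒴) k M := by
  induction m with
  | zero => exact ⟨0, Nat.zero_le _, hM⟩
  | succ m ih =>
    by_cases hmn : m + 1 ≤ n
    · exact ⟨m + 1, hmn, hM⟩
    · obtain ⟨j, rfl⟩ : ∃ j, m = n + j := ⟨m - n, by lia⟩
      refine ih (F.hasResolution_of_vanishing _ hM fun P hP' => ?_)
      rw [show n + j + 1 = n + 1 + j by lia]
      exact hP P hP' j

end IsProjectiveFrame

end Core

/-! ### Acyclic complexes as spliced short exact sequences. -/

section Splicing

variable {C : Type u} [Category.{v} C] [Abelian C]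

/-- A complex is spliced from the short exact sequences `0 ⟶ A n ⟶ K n ⟶ A (n + 1) ⟶ 0`. -/
structure IsSplicedFrom (K : CochainComplex C ℤ) (A : ℤ → C) (f : ∀ n, A n ⟶ K.X n)
    (g : ∀ n, K.X n ⟶ A (n + 1)) : Prop where
  zero : ∀ n, f n ≫ g n = 0
  shortExact : ∀ n, (ShortComplex.mk (f n) (g n) (zero n)).ShortExact
  d_eq : ∀ n, K.d n (n + 1) = g n ≫ f (n + 1)

lemma isSplicedFrom_cycles {K : CochainComplex C ℤ} (hK : K.Acyclic) :
    IsSplicedFrom K (fun n => K.cycles n) (fun n => K.iCycles n) (fun n => K.toCycles n (n + 1)) where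
  zero n := by rw [← cancel_mono (K.iCycles _)]; simp
  shortExact n := by
    have hex := hK (n + 1)
    rw [K.exactAt_iff' n (n + 1) (n + 1 + 1) (by simp) (by simp)] at hex
    have : Epi (K.toCycles n (n + 1)) := by
      rw [epi_iff_surjective_up_to_refinements]
      intro T y
      have hy : (y ≫ K.iCycles (n + 1)) ≫ K.d (n + 1) (n + 1 + 1) = 0 := by
        rw [Category.assoc, K.iCycles_d, comp_zero]
      have : ∃ (T' : C) (π : T' ⟶ T) (_ : Epi π) (x : T' ⟶ K.X n),
          π ≫ y ≫ K.iCycles (n + 1) = x ≫ K.d n (n + 1) :=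
        hex.exact_up_to_refinements (y ≫ K.iCycles (n + 1)) hy
      obtain ⟨T', π, hπ, x, hx⟩ := this
      refine ⟨T', π, hπ, x, ?_⟩
      rw [← cancel_mono (K.iCycles _), Category.assoc, Category.assoc, K.toCycles_i, hx]
    refine shortExact_of_exists_lift _ fun k hk => ?_
    have hk' : k ≫ K.d n (n + 1) = 0 := by rw [← K.toCycles_i, reassoc_of% hk, zero_comp]
    exact ⟨K.liftCycles k (n + 1) (by simp) hk', by simp⟩
  d_eq n := by simp

/-- The complex spliced from a sequence of short exact sequences. -/
noncomputable def spliceComplex (A X : ℤ → C) (f : ∀ n, A n ⟶ X n) (g : ∀ n, X n ⟶ A (n + 1))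
    (w : ∀ n, f n ≫ g n = 0) : CochainComplex C ℤ :=
  CochainComplex.of X (fun n => g n ≫ f (n + 1)) fun n => by simp [reassoc_of% w]

lemma isSplicedFrom_spliceComplex (A X : ℤ → C) (f : ∀ n, A n ⟶ X n) (g : ∀ n, X n ⟶ A (n + 1))
    (w : ∀ n, f n ≫ g n = 0) (h : ∀ n, (ShortComplex.mk (f n) (g n) (w n)).ShortExact) :
    IsSplicedFrom (spliceComplex A X f g w) A f g where
  zero := w
  shortExact := h
  d_eq n := CochainComplex.of_d X (fun n => g n ≫ f (n + 1)) n

namespace IsSplicedFrom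

variable {K : CochainComplex C ℤ} {A : ℤ → C} {f : ∀ n, A n ⟶ K.X n} {g : ∀ n, K.X n ⟶ A (n + 1)}

include f g

lemma acyclic (h : IsSplicedFrom K A f g) : K.Acyclic := by
  intro m
  obtain ⟨n, rfl⟩ : ∃ n, m = n + 1 := ⟨m - 1, by simp⟩
  rw [K.exactAt_iff' n (n + 1) (n + 1 + 1) (by simp) (by simp)]
  -- Exactness is transported in two moves: `φ` composes the second map with the monomorphism `f`,
  -- and `ψ` strips the epimorphism `g n` from the first differential.
  let φ : ShortComplex.mk (K.d n (n + 1)) (g (n + 1)) (by rw [h.d_eq, Category.assoc, h.zero,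
      comp_zero]) ⟶ K.sc' n (n + 1) (n + 1 + 1) :=
    { τ₁ := 𝟙 _, τ₂ := 𝟙 _, τ₃ := f (n + 1 + 1), 
      comm₁₂ := (Category.id_comp _).trans (Category.comp_id _).symm
      comm₂₃ := (Category.id_comp _).trans (h.d_eq (n + 1)) }
  let ψ : ShortComplex.mk (K.d n (n + 1)) (g (n + 1)) (by rw [h.d_eq, Category.assoc, h.zero,
      comp_zero]) ⟶ ShortComplex.mk (f (n + 1)) (g (n + 1)) (h.zero (n + 1)) :=
    { τ₁ := g n, τ₂ := 𝟙 _, τ₃ := 𝟙 _, 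
      comm₁₂ := (h.d_eq n).symm.trans (Category.comp_id _).symm }
  have : Epi ψ.τ₁ := (h.shortExact n).epi_g
  have : IsIso ψ.τ₂ := inferInstanceAs (IsIso (𝟙 _))
  have : Mono ψ.τ₃ := inferInstanceAs (Mono (𝟙 _))
  have : Epi φ.τ₁ := inferInstanceAs (Epi (𝟙 _))
  have : IsIso φ.τ₂ := inferInstanceAs (IsIso (𝟙 _))
  have : Mono φ.τ₃ := (h.shortExact (n + 1 + 1)).mono_f
  rw [← ShortComplex.exact_iff_of_epi_of_isIso_of_mono φ,
    ShortComplex.exact_iff_of_epi_of_isIso_of_mono ψ]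
  exact (h.shortExact (n + 1)).exact

lemma nonempty_cycles_iso (h : IsSplicedFrom K A f g) (n : ℤ) : Nonempty (K.cycles n ≅ A n) := by
  have := (h.shortExact n).mono_f
  have := (h.shortExact (n + 1)).mono_f
  dsimp at *
  obtain ⟨l, hl⟩ := exists_lift_of_shortExact (h.shortExact n) (K.iCycles n) (by
    rw [← cancel_mono (f (n + 1)), Category.assoc, ← h.d_eq, K.iCycles_d, zero_comp])
  have hf : f n ≫ K.d n (n + 1) = 0 := by rw [h.d_eq, reassoc_of% h.zero n, zero_comp]
  refine ⟨⟨l, K.liftCycles (f n) (n + 1) (by simp) hf, ?_, ?_⟩⟩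
  · rw [← cancel_mono (K.iCycles n)]; simp [hl]
  · rw [← cancel_mono (f n)]; simp [hl]

/-- A cocycle on `K.X n` is a map out of `A (n + 1)` composed with `g n`; it is a coboundary exactly
when that map extends along `f (n + 1)`. -/
lemma homToExact_iff (h : IsSplicedFrom K A f g) (Y : C) :
    HomToExact K Y ↔ ∀ n (u : A n ⟶ Y), ∃ t : K.X n ⟶ Y, f n ≫ t = u := by
  constructor
  · intro hK m
    obtain ⟨n, rfl⟩ : ∃ n, m = n + 1 := ⟨m - 1, by simp⟩
    intro u
    have := (h.shortExact n).epi_g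
    dsimp at this
    obtain ⟨t, ht⟩ := hK n (g n ≫ u) (by
      obtain ⟨k, rfl⟩ : ∃ k, n = k + 1 := ⟨n - 1, by simp⟩
      rw [add_sub_cancel_right, h.d_eq, Category.assoc, reassoc_of% h.zero, zero_comp, comp_zero])
    refine ⟨t, ?_⟩
    rwa [h.d_eq, Category.assoc, cancel_epi] at ht
  · intro hA m u hu
    obtain ⟨n, rfl⟩ : ∃ n, m = n + 1 := ⟨m - 1, by simp⟩
    have := (h.shortExact n).epi_g
    dsimp at this
    rw [add_sub_cancel_right, h.d_eq, Category.assoc, ← comp_zero, cancel_epi] at hu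
    obtain ⟨l, hl⟩ := exists_desc_of_shortExact (h.shortExact (n + 1)) u hu
    obtain ⟨t, rfl⟩ := hA _ l
    exact ⟨t, by rw [h.d_eq, Category.assoc, hl]⟩

lemma homFromExact_iff (h : IsSplicedFrom K A f g) (Z : C) :
    HomFromExact K Z ↔ ∀ n (u : Z ⟶ A (n + 1)), ∃ t : Z ⟶ K.X n, t ≫ g n = u := by
  constructor
  · intro hK n u
    have := (h.shortExact (n + 1)).mono_f
    dsimp at this
    have key := hK (n + 1) (u ≫ f (n + 1)) (by
      rw [h.d_eq, Category.assoc, reassoc_of% h.zero, zero_comp, comp_zero])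
    rw [add_sub_cancel_right] at key
    obtain ⟨t, ht⟩ := key
    refine ⟨t, ?_⟩
    rwa [h.d_eq, ← Category.assoc, cancel_mono] at ht
  · intro hA m u hu
    obtain ⟨n, rfl⟩ : ∃ n, m = n + 1 := ⟨m - 1, by simp⟩
    have := (h.shortExact (n + 1 + 1)).mono_f
    dsimp at this
    rw [h.d_eq, ← Category.assoc, ← zero_comp, cancel_mono] at hu
    obtain ⟨l, hl⟩ := exists_lift_of_shortExact (h.shortExact (n + 1)) u hu
    obtain ⟨t, rfl⟩ := hA _ l
    rw [add_sub_cancel_right]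
    exact ⟨t, by rw [h.d_eq, ← Category.assoc, hl]⟩

end IsSplicedFrom

end Splicing

/-- Chosen successors are iterated for nonnegative indices and chosen predecessors for negative
ones; the two halves meet at `m`. -/
lemma exists_int_chain {α : Type*} {R : α → α → Prop} (hnext : ∀ a, ∃ b, R a b)
    (hprev : ∀ b, ∃ a, R a b) (m : α) : ∃ A : ℤ → α, A 0 = m ∧ ∀ n, R (A n) (A (n + 1)) := by
  choose nx hnx using hnext
  choose pv hpv using hprev
  let A : ℤ → α := fun n => match n with
    | Int.ofNat k => nx^[k] m
    | Int.negSucc k => pv^[k + 1] m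
  refine ⟨A, rfl, fun n => ?_⟩
  match n with
  | Int.ofNat k =>
    change R (nx^[k] m) (nx^[k + 1] m)
    rw [Function.iterate_succ_apply']
    exact hnx _
  | Int.negSucc 0 => exact hpv m
  | Int.negSucc (k + 1) =>
    change R (pv^[k + 1 + 1] m) (pv^[k + 1] m)
    rw [Function.iterate_succ_apply' pv (k + 1)]
    exact hpv _

/-! ### Gorenstein objects as syzygy objects, and duality. -/

section Sequences

variable {C : Type u} [Category.{v} C] [Abelian C]

/-- There is a short exact sequence `0 ⟶ A ⟶ B ⟶ D ⟶ 0` such that all morphisms from `A` to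
objects of `𝒴` extend to `B`. -/
def HasExtendingSES (𝒴 : ObjectProperty C) (A B D : C) : Prop :=
  ∃ (f : A ⟶ B) (g : B ⟶ D) (w : f ≫ g = 0), (ShortComplex.mk f g w).ShortExact ∧
    ∀ Y, 𝒴 Y → ∀ u : A ⟶ Y, ∃ t : B ⟶ Y, f ≫ t = u

/-- There is a short exact sequence `0 ⟶ A ⟶ B ⟶ D ⟶ 0` such that all morphisms from objects of
`𝒵` to `D` lift to `B`. -/
def HasLiftingSES (𝒵 : ObjectProperty C) (A B D : C) : Prop :=
  ∃ (f : A ⟶ B) (g : B ⟶ D) (w : f ≫ g = 0), (ShortComplex.mk f g w).ShortExact ∧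
    ∀ Z, 𝒵 Z → ∀ u : Z ⟶ D, ∃ t : Z ⟶ B, t ≫ g = u

lemma gorensteinProjective_iff (𝒳 𝒴 : ObjectProperty C) (M : C) :
    GorensteinProjective 𝒳 𝒴 M ↔ ∃ A X : ℤ → C, (∀ n, 𝒳 (X n)) ∧
      (∀ n, HasExtendingSES 𝒴 (A n) (X n) (A (n + 1))) ∧ ∃ n, Nonempty (A n ≅ M) := by
  constructor
  · rintro ⟨K, hK, hX, hY, hM⟩
    have h := isSplicedFrom_cycles hK
    exact ⟨_, K.X, hX, fun n => ⟨_, _, h.zero n, h.shortExact n,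
      fun Y hY' => (h.homToExact_iff Y).1 (hY Y hY') n⟩, hM⟩
  · rintro ⟨A, X, hX, hA, n, ⟨e⟩⟩
    choose f g w hs hY using hA
    have h := isSplicedFrom_spliceComplex A X f g w hs
    obtain ⟨e'⟩ := h.nonempty_cycles_iso n
    exact ⟨_, h.acyclic, hX, fun Y hY' => (h.homToExact_iff Y).2 fun n => hY n Y hY', n,
      ⟨e' ≪≫ e⟩⟩

lemma gorensteinInjective_iff (𝒵 𝒲 : ObjectProperty C) (M : C) :
    GorensteinInjective 𝒵 𝒲 M ↔ ∃ A X : ℤ → C, (∀ n, 𝒲 (X n)) ∧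
      (∀ n, HasLiftingSES 𝒵 (A n) (X n) (A (n + 1))) ∧ ∃ n, Nonempty (A n ≅ M) := by
  constructor
  · rintro ⟨K, hK, hX, hY, hM⟩
    have h := isSplicedFrom_cycles hK
    exact ⟨_, K.X, hX, fun n => ⟨_, _, h.zero n, h.shortExact n,
      fun Y hY' => (h.homFromExact_iff Y).1 (hY Y hY') n⟩, hM⟩
  · rintro ⟨A, X, hX, hA, n, ⟨e⟩⟩
    choose f g w hs hY using hA
    have h := isSplicedFrom_spliceComplex A X f g w hs
    obtain ⟨e'⟩ := h.nonempty_cycles_iso n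
    exact ⟨_, h.acyclic, hX, fun Y hY' => (h.homFromExact_iff Y).2 fun n => hY n Y hY', n,
      ⟨e' ≪≫ e⟩⟩

lemma HasLiftingSES.op {𝒵 : ObjectProperty C} {A B D : C} (h : HasLiftingSES 𝒵 A B D) :
    HasExtendingSES 𝒵.op (Opposite.op D) (Opposite.op B) (Opposite.op A) := by
  obtain ⟨f, g, w, h, hZ⟩ := h
  refine ⟨g.op, f.op, by rw [← op_comp, w]; rfl, h.op, fun Z hZ' u => ?_⟩
  obtain ⟨t, ht⟩ := hZ Z.unop hZ' u.unop
  exact ⟨t.op, Quiver.Hom.unop_inj ht⟩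

lemma HasExtendingSES.unop {𝒵 : ObjectProperty C} {A B D : Cᵒᵖ}
    (h : HasExtendingSES 𝒵.op A B D) : HasLiftingSES 𝒵 D.unop B.unop A.unop := by
  obtain ⟨f, g, w, h, hZ⟩ := h
  refine ⟨g.unop, f.unop, by rw [← unop_comp, w]; rfl, h.unop, fun Z hZ' u => ?_⟩
  obtain ⟨t, ht⟩ := hZ (Opposite.op Z) hZ' u.op
  exact ⟨t.unop, Quiver.Hom.op_inj ht⟩

/-- Relative Gorenstein injective objects are relative Gorenstein projective objects of the
opposite category. -/
lemma gorensteinInjective_iff_op (𝒵 𝒲 : ObjectProperty C) (M : C) :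
    GorensteinInjective 𝒵 𝒲 M ↔ GorensteinProjective 𝒲.op 𝒵.op (Opposite.op M) := by
  rw [gorensteinInjective_iff, gorensteinProjective_iff]
  constructor
  · rintro ⟨A, X, hX, hA, n, ⟨e⟩⟩
    -- `X n` sits between `A n` and `A (n + 1)`, so reflecting the cycles by `-n` reflects the terms
    -- by `-(n + 1)`.
    refine ⟨fun n => Opposite.op (A (-n)), fun n => Opposite.op (X (-(n + 1))),
      fun n => hX _, fun n => ?_, -n, ⟨?_⟩⟩
    · have := (hA (-(n + 1))).op
      rwa [show -(n + 1) + 1 = -n by lia] at this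
    · dsimp only
      rw [neg_neg]
      exact e.symm.op
  · rintro ⟨A, X, hX, hA, n, ⟨e⟩⟩
    refine ⟨fun n => (A (-n)).unop, fun n => (X (-(n + 1))).unop,
      fun n => hX _, fun n => ?_, -n, ⟨?_⟩⟩
    · have := (hA (-(n + 1))).unop
      rwa [show -(n + 1) + 1 = -n by lia] at this
    · dsimp only
      rw [neg_neg]
      exact e.symm.unop

variable {E : ℕ → C → C → Prop} {𝒳 𝒴 : ObjectProperty C}

/-- The extension property yields `Ext^1` vanishing of cycles against `𝒴`, and shifting along the
complex yields the higher degrees. Conversely, the right half of a complex comes from the syzygy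
embeddings, and the left half from `𝒳`-covers, whose kernels stay orthogonal to `𝒴`. -/
lemma IsProjectiveFrame.gorensteinProjective_iff_syzygyObject (F : IsProjectiveFrame E 𝒳 𝒴)
    (hepi : ∀ A : C, ∃ (X : C) (p : X ⟶ A), 𝒳 X ∧ Epi p) (M : C) :
    GorensteinProjective 𝒳 𝒴 M ↔ SyzygyObject E 𝒳 𝒴 M := by
  have hE := F.isExtVanishing
  have hS := isSyzygyClass_syzygyObject E 𝒳 𝒴
  rw [gorensteinProjective_iff]
  constructor
  · rintro ⟨A, X, hX, hA, m, ⟨e⟩⟩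
    have hv (i : ℕ) : ∀ n Y, 𝒴 Y → E (i + 1) (A (n + 1)) Y := by
      induction i with
      | zero =>
        intro n Y hY
        obtain ⟨f, g, w, h, hu⟩ := hA n
        exact hE.of_extend h Y (hu Y hY) (F.orthogonal _ _ (hX n) hY 0)
      | succ i ih =>
        intro n Y hY
        obtain ⟨f, g, w, h, -⟩ := hA n
        refine hE.right ⟨f, g, w, h⟩ _ Y ?_ (F.orthogonal _ _ (hX n) hY _)
        have := ih (n - 1) Y hY
        rwa [sub_add_cancel] at this
    refine F.syzygyObject_of_iso e ⟨fun N => ∃ n, N = A n, ?_, m, rfl⟩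
    rintro _ ⟨n, rfl⟩
    obtain ⟨f, g, w, h, -⟩ := hA n
    refine ⟨fun Y hY i => ?_, X n, A (n + 1), hX n, ⟨_, rfl⟩, f, g, w, h⟩
    have := hv i (n - 1) Y hY
    rwa [sub_add_cancel] at this
  · intro hM
    let R : {N // SyzygyObject E 𝒳 𝒴 N} → {N // SyzygyObject E 𝒳 𝒴 N} → Prop :=
      fun N N' => ∃ X, 𝒳 X ∧ HasExtendingSES 𝒴 N.1 X N'.1
    have hR {N N' X : C} (hX : 𝒳 X) (h : HasSES N X N') (hN : SyzygyObject E 𝒳 𝒴 N)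
        (hN' : SyzygyObject E 𝒳 𝒴 N') : R ⟨N, hN⟩ ⟨N', hN'⟩ := by
      obtain ⟨f, g, w, h⟩ := h
      exact ⟨X, hX, f, g, w, h, fun Y hY u => hE.extend h Y (F.vanishing hN' hY 0) u⟩
    have hnext : ∀ N, ∃ N', R N N' := by
      rintro ⟨N, hN⟩
      obtain ⟨-, X, N', hX, hN', h⟩ := hS N hN
      exact ⟨⟨N', hN'⟩, hR hX h hN hN'⟩
    have hprev : ∀ N, ∃ N', R N' N := by
      rintro ⟨N, hN⟩
      obtain ⟨X, p, hX, hp⟩ := hepi N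
      have h : HasSES (kernel p) X N := ⟨kernel.ι p, p, kernel.condition p,
        shortExact_of_exists_lift _ fun k hk => ⟨kernel.lift p k hk, kernel.lift_ι _ _ _⟩⟩
      have hK : SyzygyObject E 𝒳 𝒴 (kernel p) := syzygyObject_of_hasSES h hX hN fun Y hY i =>
        hE.left h _ _ (F.orthogonal _ _ hX hY i) (F.vanishing hN hY (i + 1))
      exact ⟨⟨kernel p, hK⟩, hR hX h hK hN⟩
    obtain ⟨A, hA, hAR⟩ := exists_int_chain hnext hprev ⟨M, hM⟩
    choose X hX hs using hAR
    exact ⟨fun n => (A n).1, X, hX, hs, 0, ⟨eqToIso (congrArg Subtype.val hA)⟩⟩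

lemma hasCoresolution_iff_op (P : ObjectProperty C) (n : ℕ) (M : C) :
    HasCoresolution P n M ↔ HasResolution P.op n (Opposite.op M) := by
  induction n generalizing M with
  | zero =>
    exact ⟨fun ⟨X, hX, ⟨e⟩⟩ => ⟨Opposite.op X, hX, ⟨e.op⟩⟩,
      fun ⟨X, hX, ⟨e⟩⟩ => ⟨X.unop, hX, ⟨e.unop⟩⟩⟩
  | succ n ih =>
    constructor
    · rintro ⟨X, L, f, g, w, h, hX, hL⟩
      exact ⟨Opposite.op L, Opposite.op X, g.op, f.op, by rw [← op_comp, w]; rfl, h.op, hX,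
        (ih L).1 hL⟩
    · rintro ⟨L, X, g, f, w, h, hX, hL⟩
      exact ⟨X.unop, L.unop, f.unop, g.unop, by rw [← unop_comp, w]; rfl, h.unop, hX,
        (ih L.unop).2 hL⟩

lemma exists_of_resdim_le {P : ObjectProperty C} {M : C} {n : ℕ} (h : resdim P M ≤ n) :
    ∃ k ≤ n, HasResolution P k M := by
  by_contra! hn
  have : ((n + 1 : ℕ) : ℕ∞) ≤ resdim P M := le_iInf₂ fun k hk => by
    have : n < k := by
      by_contra! hkn
      exact hn k hkn hk
    exact_mod_cast this
  have := this.trans h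
  rw [Nat.cast_le] at this
  lia

lemma resdim_le {P : ObjectProperty C} {M : C} {n : ℕ} (h : HasResolution P n M) :
    resdim P M ≤ n :=
  iInf₂_le n h

lemma coresdim_eq_op (P : ObjectProperty C) (M : C) :
    coresdim P M = resdim P.op (Opposite.op M) := by
  simp only [coresdim, resdim, hasCoresolution_iff_op]

end Sequences

/-! ### Admissible pairs as frames. -/

section Frames

variable {C : Type u} [Category.{v} C] [Abelian C] {𝒳 𝒴 𝒵 𝒲 : ObjectProperty C}

lemma IsGPAdmissible.isProjectiveFrame (h : IsGPAdmissible 𝒳 𝒴)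
    (hProj : 𝒳 ⊓ 𝒴 = isProjective C) : IsProjectiveFrame ExtVanishes 𝒳 𝒴 where
  isExtVanishing := isExtVanishing_extVanishes
  closed_ext := h.closed_ext
  cogenerator X hX := by
    obtain ⟨W, X', i, p, w, hs, h₁, h₂, h₃⟩ := h.cogenerator X hX
    have : (𝒳 ⊓ 𝒴) W := ⟨h₁, h₂⟩
    rw [hProj] at this
    exact ⟨W, X', this, h₃, i, p, w, hs⟩
  orthogonal X Y hX hY i := h.orthogonal hX hY _ (Nat.succ_pos i)
  left_of_projective P hP := by
    have : isProjective C P := hP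
    rw [← hProj] at this
    exact this.1
  right_of_projective P hP := by
    have : isProjective C P := hP
    rw [← hProj] at this
    exact this.2

lemma IsGIAdmissible.isProjectiveFrame_op (h : IsGIAdmissible 𝒵 𝒲)
    (hInj : 𝒵 ⊓ 𝒲 = isInjective C) : IsProjectiveFrame OpExtVanishes 𝒲.op 𝒵.op where
  isExtVanishing := isExtVanishing_opExtVanishes
  closed_ext := ⟨fun {S} hS h₁ h₃ => by
    have := h.closed_ext
    exact 𝒲.prop_X₂_of_shortExact hS.unop h₃ h₁⟩
  cogenerator X hX := by
    obtain ⟨W', V, i, p, w, hs, h₁, h₂, h₃⟩ := h.generator X.unop hX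
    have : (𝒵 ⊓ 𝒲) V := ⟨h₁, h₂⟩
    rw [hInj] at this
    have : Injective V := this
    exact ⟨Opposite.op V, Opposite.op W', inferInstance, h₃,
      HasSES.op ⟨i, p, w, hs⟩⟩
  orthogonal X Y hX hY i := h.orthogonal hY hX _ (Nat.succ_pos i)
  left_of_projective P hP := by
    have : isInjective C P.unop := (inferInstance : Injective P.unop)
    rw [← hInj] at this
    exact this.2
  right_of_projective P hP := by
    have : isInjective C P.unop := (inferInstance : Injective P.unop)
    rw [← hInj] at this
    exact this.1

lemma IsGIAdmissible.gorensteinInjective_iff_syzygyObject (h : IsGIAdmissible 𝒵 𝒲)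
    (hInj : 𝒵 ⊓ 𝒲 = isInjective C) (M : Cᵒᵖ) : (GorensteinInjective 𝒵 𝒲).op M ↔
      SyzygyObject OpExtVanishes 𝒲.op 𝒵.op M := by
  rw [← (h.isProjectiveFrame_op hInj).gorensteinProjective_iff_syzygyObject fun A => ?_]
  · exact gorensteinInjective_iff_op 𝒵 𝒲 M.unop
  · obtain ⟨W, i, hW, hi⟩ := h.exists_mono A.unop
    exact ⟨Opposite.op W, i.op, hW, inferInstance⟩

lemma glGID_eq_iSup_op (𝒵 𝒲 : ObjectProperty C) :
    glGID 𝒵 𝒲 = ⨆ M : Cᵒᵖ, resdim (GorensteinInjective 𝒵 𝒲).op M := by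
  refine le_antisymm (iSup_le fun M => ?_) (iSup_le fun M => ?_)
  · rw [Gid, coresdim_eq_op]
    exact le_iSup (resdim (GorensteinInjective 𝒵 𝒲).op) (Opposite.op M)
  · exact (coresdim_eq_op (GorensteinInjective 𝒵 𝒲) M.unop).symm.le.trans
      (le_iSup (fun M => Gid 𝒵 𝒲 M) M.unop)

end Frames

/-! ### Comparison of the two global dimensions. -/

section Comparison

variable {C : Type u} [Category.{v} C] [Abelian C]

/-- The global dimension attached to `(𝒳, 𝒴)` is at most the one attached to a frame `(𝒳', 𝒴')` in
a category `D` that receives `C` contravariantly, so that projective objects become injective. -/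
lemma IsProjectiveFrame.iSup_resdim_le {E : ℕ → C → C → Prop} {𝒳 𝒴 : ObjectProperty C}
    (F : IsProjectiveFrame E 𝒳 𝒴) {D : Type u} [Category.{v} D] [Abelian D]
    {E' : ℕ → D → D → Prop} {𝒳' 𝒴' : ObjectProperty D} (F' : IsProjectiveFrame E' 𝒳' 𝒴')
    (φ : C → D) (hφ : ∀ P, Projective P → Injective (φ P))
    (hEE' : ∀ i M P, E' i (φ P) (φ M) → E i M P)
    (hfin : finiteResdim (SyzygyObject E 𝒳 𝒴) = ⊤) :
    ⨆ M, resdim (SyzygyObject E 𝒳 𝒴) M ≤ ⨆ M, resdim (SyzygyObject E' 𝒳' 𝒴') M := by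
  generalize hN : ⨆ M, resdim (SyzygyObject E' 𝒳' 𝒴') M = N
  induction N using ENat.recTopCoe with
  | top => exact le_top
  | coe n =>
    refine iSup_le fun M => ?_
    have hM : finiteResdim (SyzygyObject E 𝒳 𝒴) M := by rw [hfin]; trivial
    obtain ⟨m, hm⟩ := ENat.ne_top_iff_exists.1 (ne_of_lt hM)
    obtain ⟨l, -, hl⟩ := exists_of_resdim_le hm.ge
    obtain ⟨k, hk, hr⟩ := F.exists_hasResolution_le n l hl fun P hP j => by
      have := hφ P hP
      obtain ⟨k, hk, hr⟩ := exists_of_resdim_le (P := SyzygyObject E' 𝒳' 𝒴') (M := φ P) (n := n)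
        (by rw [← hN]; exact le_iSup (fun M => resdim (SyzygyObject E' 𝒳' 𝒴') M) _)
      -- `φ P` is injective, so vanishing holds above its own length `k`; the shift `n - k` aligns
      -- this with the uniform bound `n`.
      have := F'.vanishing_of_injective k hr (n - k + j) (φ M)
      rw [show k + 1 + (n - k + j) = n + 1 + j by lia] at this
      exact hEE' _ _ _ this
    exact (resdim_le hr).trans (by exact_mod_cast hk)

end Comparison

end RelGorenstein

theorem corollary3p6 {C : Type u} [Category.{v} C] [Abelian C]
    (𝒳 𝒴 𝒵 𝒲 : ObjectProperty C)
    (hXY : RelGorenstein.IsGPAdmissible 𝒳 𝒴)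
    (hProj : 𝒳 ⊓ 𝒴 = isProjective C)
    (hZW : RelGorenstein.IsGIAdmissible 𝒵 𝒲)
    (hInj : 𝒵 ⊓ 𝒲 = isInjective C)
    (hGP : RelGorenstein.finiteResdim (RelGorenstein.GorensteinProjective 𝒳 𝒴) = ⊤)
    (hGI : RelGorenstein.finiteCoresdim (RelGorenstein.GorensteinInjective 𝒵 𝒲) = ⊤) :
    RelGorenstein.glGPD 𝒳 𝒴 = RelGorenstein.glGID 𝒵 𝒲 := by
  have F := hXY.isProjectiveFrame hProj
  have F' := hZW.isProjectiveFrame_op hInj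
  have e : RelGorenstein.GorensteinProjective 𝒳 𝒴 = _ :=
    funext fun M => propext (F.gorensteinProjective_iff_syzygyObject hXY.exists_epi M)
  have e' : (RelGorenstein.GorensteinInjective 𝒵 𝒲).op = _ :=
    funext fun M => propext (hZW.gorensteinInjective_iff_syzygyObject hInj M)
  have hGI' : RelGorenstein.finiteResdim (RelGorenstein.GorensteinInjective 𝒵 𝒲).op = ⊤ := by
    ext M
    have h : RelGorenstein.finiteCoresdim (RelGorenstein.GorensteinInjective 𝒵 𝒲) M.unop := by
      rw [hGI]; trivial
    rw [RelGorenstein.finiteCoresdim, RelGorenstein.coresdim_eq_op] at h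
    exact ⟨fun _ => trivial, fun _ => h⟩
  rw [RelGorenstein.glGID_eq_iSup_op, RelGorenstein.glGPD]
  unfold RelGorenstein.Gpd
  rw [e] at hGP ⊢
  rw [e'] at hGI' ⊢
  refine le_antisymm ?_ ?_
  · exact F.iSup_resdim_le F' Opposite.op (fun P hP => inferInstance) (fun i M P h => h) hGP
  · exact F'.iSup_resdim_le F Opposite.unop (fun P hP => inferInstance) (fun i M P h => h) hGI'
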